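/- Let $n\ge 3$, $S=\mathrm{SO}(n)$, $H=\{h\in S: he_n=e_n\}\cong\mathrm{SO}(n-1)$, $\mathfrak h=\{Y\in\mathfrak{so}(n): Ye_n=0\}$, and $\langle A,B\rangle=-\tfrac12\operatorname{tr}(AB)$ on $\mathfrak{so}(n)$. Let $Y_\alpha$ be an orthonormal basis of $\mathfrak h$, and let the inertia tensor $\mathbb I:\mathfrak{so}(n)\to\mathfrak{so}(n)$ be symmetric and positive definite with respect to $\langle\cdot,\cdot\rangle$. Trivialize $TS=S\times\mathfrak{so}(n)$ by left translations, and let $H$ act on $TS$ by $h\cdot(s,u)=(hs,u)$, with infinitesimal generators $\zeta_Y(s,u)=(\mathrm{Ad}(s^{-1})Y,0)$, $Y\in\mathfrak h$. The $n$-dimensional Chaplygin ball has the configuration space $Q=S\times\mathbb R^{n-1}$ with the metric $\mu=\langle\mathbb I\cdot,\cdot\rangle+\langle\cdot,\cdot\rangle_E$ and the rolling constraint $x'=-\mathcal A_s(u)$, where $\mathcal A_s(u)=-\sum_{a=1}^{n-1}\langle e_a,(\mathrm{Ad}(s)u)e_n\rangle_E\,e_a$. Identify $T^*S$ with $TS$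 through the induced metric $\mu_0(u,v)=\langle\mathbb Iu,v\rangle+\langle\mathcal A_s(u),\mathcal A_s(v)\rangle_E$ on $S$, and let $\Omega^S=-d\theta$ be the canonical symplectic form, where $\theta_{(s,u)}(v,w)=\mu_0(u,v)$. Let $\mathcal H_c(s,u)=\tfrac12\langle\mathbb Iu,u\rangle+\tfrac12|\mathcal A_s(u)|^2$ be the compressed Hamiltonian, let $\Omega_{nh}=\Omega^S-\langle J_V\circ\mathrm{hl},d\mathcal A\rangle$ be the non-holonomic two-form on $TS$, where $(J_V\circ\mathrm{hl})(s,u)=-\langle\mathcal A_s(u),\cdot\rangle_E$ is the momentum map of the translations of $\mathbb R^{n-1}$ at the horizontal lift of $u$, and let $X_{nh}$ be the vector field determined by $i(X_{nh})\Omega_{nh}=d\mathcal H_c$. Put $\rho^\alpha_s(u)=\langle Y_\alpha,\mathrm{Ad}(s)u\rangle$, and let $\omega=\sum_\alpha\rho^\alpha\otimes Y_\alpha$ be the standard $H$-connection on $S\to S/H=S^{n-1}$, with curvature $\mathrm{Curv}^\omega=d\omega-\tfrac12[\omega,\omega]$. Let $L(s,u)=\sum_\alpha\rho^\alpha_s(u)Y_\alpha$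 and $J_H(s,u)=\sum_\alpha\rho^\alpha_s(\mathbb Iu)Y_\alpha$ (with $\mathfrak h^*=\mathfrak h$ through $\langle\cdot,\cdot\rangle$), and define $$\widetilde\Omega=\Omega^S-\langle L,\mathrm{Curv}^\omega\rangle .$$ Theorem. (1) $\widetilde\Omega$ is an almost symplectic form on $TS$ (a smooth two-form that is non-degenerate and not closed), and it is $H$-invariant. (2) The vector field $X_{nh}$ exists and is unique, and $i(X_{nh})\widetilde\Omega=d\mathcal H_c$. (3) $J_H$ is a momentum map of the $H$-action on $(TS,\widetilde\Omega)$: $J_H$ is smooth and $i(\zeta_Y)\widetilde\Omega=d\langle J_H,Y\rangle$ for all $Y\in\mathfrak h$. -/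

import Mathlib

open scoped Matrix ContDiff

attribute [local instance] Matrix.frobeniusNormedAddCommGroup Matrix.frobeniusNormedSpace

noncomputable section

namespace Chaplygin

/-! ## The groups, the Lie algebras and the left trivialization

Throughout `n = m + 1`; the horizontal table is `ℝ^(n-1) = ℝ^m`, and the vertical unit vector
`e_n` is the last standard basis vector. -/

/-- The real `n × n` matrices. -/
abbrev Mat (m : ℕ) : Type := Matrix (Fin (m + 1)) (Fin (m + 1)) ℝ

/-- The rotation group `S = SO(n)`. -/
abbrev SO (m : ℕ) : Type := Matrix.specialOrthogonalGroup (Fin (m + 1)) ℝ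

/-- The Lie algebra `𝔰𝔬(n)` of skew-symmetric matrices, as a linear subspace of the matrices. -/
def soSubmodule (m : ℕ) : Submodule ℝ (Mat m) where
  carrier := {A | Aᵀ = -A}
  zero_mem' := by
    change (0 : Mat m)ᵀ = -0
    simp
  add_mem' := by
    intro A B (hA : Aᵀ = -A) (hB : Bᵀ = -B)
    change (A + B)ᵀ = -(A + B)
    rw [Matrix.transpose_add, hA, hB, neg_add]
  smul_mem' := by
    intro c A (hA : Aᵀ = -A)
    change (c • A)ᵀ = -(c • A)
    rw [Matrix.transpose_smul, hA, smul_neg]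

/-- The Lie algebra `𝔰𝔬(n)`; it inherits the (Frobenius) norm of the matrices, of which only the
topology is used. -/
abbrev so (m : ℕ) : Type := soSubmodule m

/-- The translation group `V = ℝ^(n-1)`, Euclidean. -/
abbrev V (m : ℕ) : Type := EuclideanSpace ℝ (Fin m)

/-- The Ad-invariant inner product `⟨A, B⟩ = -(1/2) tr (A B)` on `𝔰𝔬(n)`, i.e. the Killing form
normalized so that the matrices `E_ij - E_ji`, `i < j`, are orthonormal. -/
def ip {m : ℕ} (A B : so m) : ℝ :=
  -(1 / 2) * Matrix.trace ((A : Mat m) * (B : Mat m))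

theorem so_transpose {m : ℕ} (A : so m) :
    (A : Mat m)ᵀ = -A :=
  A.2

theorem SO_mul_transpose {m : ℕ} (s : SO m) :
    (s : Mat m) * (s : Mat m)ᵀ = 1 :=
  (Matrix.mem_orthogonalGroup_iff _ _).1 (Matrix.mem_specialOrthogonalGroup_iff.1 s.2).1

theorem SO_transpose_mul {m : ℕ} (s : SO m) :
    (s : Mat m)ᵀ * (s : Mat m) = 1 :=
  (Matrix.mem_orthogonalGroup_iff' _ _).1 (Matrix.mem_specialOrthogonalGroup_iff.1 s.2).1

/-- The Lie bracket of `𝔰𝔬(n)`: the commutator `[A, B] = A B - B A`. -/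
def lie {m : ℕ} (A B : so m) : so m :=
  ⟨(A : Mat m) * (B : Mat m) - (B : Mat m) * (A : Mat m), by
    change ((A : Mat m) * (B : Mat m) - (B : Mat m) * (A : Mat m))ᵀ =
      -((A : Mat m) * (B : Mat m) - (B : Mat m) * (A : Mat m))
    simp [Matrix.transpose_mul, so_transpose]⟩

/-- The adjoint action `Ad(s) u = s u s⁻¹` of `SO(n)` on `𝔰𝔬(n)` (recall `s⁻¹ = sᵀ`). -/
def Ad {m : ℕ} (s : SO m) (u : so m) : so m :=
  ⟨(s : Mat m) * u * (s : Mat m)ᵀ,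
    by
      change (_ * _ * _)ᵀ = -(_ * _ * _)
      simp [Matrix.transpose_mul, so_transpose, Matrix.mul_assoc]⟩

theorem exp_mem_SO {m : ℕ} (v : so m) :
    NormedSpace.exp (v : Mat m) ∈
      Matrix.specialOrthogonalGroup (Fin (m + 1)) ℝ := by
  have key : ∀ w : so m, NormedSpace.exp (w : Mat m) *
      (NormedSpace.exp (w : Mat m))ᵀ = 1 := by
    intro w
    rw [← Matrix.exp_transpose, so_transpose, Matrix.exp_neg]
    exact Matrix.mul_nonsing_inv _ ((Matrix.isUnit_iff_isUnit_det _).1 (Matrix.isUnit_exp _))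
  rw [Matrix.mem_specialOrthogonalGroup_iff]
  refine ⟨(Matrix.mem_orthogonalGroup_iff _ _).2 (key v), ?_⟩
  have h1 : (NormedSpace.exp (v : Mat m)).det ^ 2 = 1 := by
    have := congrArg Matrix.det (key v)
    rw [Matrix.det_mul, Matrix.det_transpose, Matrix.det_one] at this
    rw [sq, this]
  have h2 : 0 ≤ (NormedSpace.exp (v : Mat m)).det := by
    have e : (v : Mat m) = 2 • ((1 / 2 : ℝ) • v : so m) := by
      rw [show ((((1 / 2 : ℝ) • v : so m)) : Mat m) =
        (1 / 2 : ℝ) • (v : Mat m) from rfl,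
        ← Nat.cast_smul_eq_nsmul ℝ, smul_smul]
      norm_num
    rw [e, Matrix.exp_nsmul, Matrix.det_pow]
    positivity
  nlinarith

/-- The exponential map `𝔰𝔬(n) → SO(n)`. -/
def expSO {m : ℕ} (v : so m) : SO m :=
  ⟨NormedSpace.exp (v : Mat m), exp_mem_SO v⟩

/-- The phase space `TS = S × 𝔰𝔬(n)` in the left trivialization (body frame): `(s, u)` stands for
the tangent vector `s u` at `s`. -/
abbrev TS (m : ℕ) : Type := SO m × so m

/-- The model of the tangent spaces of `TS`: in the left trivialization
`T(TS) = S × 𝔰𝔬(n) × (𝔰𝔬(n) × 𝔰𝔬(n))`, and `(v, w)` at `(s, u)` is the velocity at `t = 0`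
of `t ↦ (s exp(t v), u + t w)`. -/
abbrev TT (m : ℕ) : Type := so m × so m

/-- The chart `(v, w) ↦ (s exp v, u + w)` of `TS` centred at `x = (s, u)`. -/
def chart {m : ℕ} (x : TS m) (p : TT m) : TS m := (x.1 * expSO p.1, x.2 + p.2)

section Calculus

variable {m : ℕ} {F : Type*} [NormedAddCommGroup F] [NormedSpace ℝ F]

/-- Smooth (`C^∞`) functions on `TS`. -/
def Smooth (f : TS m → F) : Prop :=
  ∀ x : TS m, ContDiff ℝ ∞ (fun p : TT m => f (chart x p))

/-- The derivative `df_s(v)` of a function on `S` along the left invariant vector field `v`. -/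
def DS (f : SO m → F) (s : SO m) (v : so m) : F :=
  deriv (fun t : ℝ => f (s * expSO (t • v))) 0

/-- The derivative `df_x(U)` of a function on `TS` along the left invariant vector field `U`. -/
def D (f : TS m → F) (x : TS m) (U : TT m) : F :=
  deriv (fun t : ℝ => f (chart x (t • U))) 0

/-- The exterior derivative of a one-form `β` on `S`, evaluated on left invariant vector fields:
`dβ(v, w) = v(β(w)) - w(β(v)) - β([v, w])`. -/
def dS (β : SO m → so m → F) (s : SO m) (v w : so m) : F :=
  DS (fun s' => β s' w) s v - DS (fun s' => β s' v) s w - β s (lie v w)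

/-- The bracket of left invariant vector fields on the Lie group `SO(n) × 𝔰𝔬(n)`, whose second
factor is the additive (abelian) group. -/
def bracketTT (U W : TT m) : TT m := (lie U.1 W.1, 0)

/-- The exterior derivative of a one-form on `TS`. -/
def d₁ (θ : TS m → TT m → ℝ) (x : TS m) (U W : TT m) : ℝ :=
  D (fun y => θ y W) x U - D (fun y => θ y U) x W - θ x (bracketTT U W)

/-- The exterior derivative of a two-form on `TS`. -/
def d₂ (Ω : TS m → TT m → TT m → ℝ) (x : TS m) (A B C : TT m) : ℝ :=
  D (fun y => Ω y B C) x A + D (fun y => Ω y C A) x B + D (fun y => Ω y A B) x C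
    - Ω x (bracketTT A B) C - Ω x (bracketTT B C) A - Ω x (bracketTT C A) B

end Calculus

/-- `Ω` is an almost symplectic form on `TS`: a smooth non-degenerate two-form which is not
closed. -/
structure IsAlmostSymplectic {m : ℕ} (Ω : TS m → TT m → TT m → ℝ) : Prop where
  form : ∀ x, ∃ B : LinearMap.BilinForm ℝ (TT m),
    (∀ U W, B U W = Ω x U W) ∧ B.IsAlt ∧ B.Nondegenerate
  smooth : ∀ U W, Smooth (fun x => Ω x U W)
  not_closed : ¬ ∀ x A B C, d₂ Ω x A B C = 0

/-- `i(X) Ω = df` on `TS`, for a vector field `X` and a two-form `Ω`. -/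
def IsHamiltonianField {m : ℕ} (Ω : TS m → TT m → TT m → ℝ) (f : TS m → ℝ)
    (X : TS m → TT m) : Prop :=
  ∀ x W, Ω x (X x) W = D f x W

/-! ## The internal symmetry group -/

/-- The internal symmetry group `H = {h ∈ SO(n) : h e_n = e_n}`. -/
def H (m : ℕ) : Subgroup (SO m) where
  carrier := {h | (h : Mat m) *ᵥ Pi.single (Fin.last m) 1 =
    Pi.single (Fin.last m) 1}
  one_mem' := Matrix.one_mulVec _
  mul_mem' := by
    intro a b (ha : _ *ᵥ _ = _) (hb : _ *ᵥ _ = _)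
    change ((a * b : SO m) : Mat m) *ᵥ _ = _
    rw [Submonoid.coe_mul, ← Matrix.mulVec_mulVec, hb, ha]
  inv_mem' := by
    intro a (ha : _ *ᵥ _ = _)
    have h : ((a⁻¹ : SO m) : Mat m) *
        (a : Mat m) = 1 := by
      rw [← Submonoid.coe_mul, inv_mul_cancel, Submonoid.coe_one]
    change ((a⁻¹ : SO m) : Mat m) *ᵥ _ = _
    conv_lhs => rw [← ha]
    rw [Matrix.mulVec_mulVec, h, Matrix.one_mulVec]

/-- The Lie algebra `𝔥 = {Y ∈ 𝔰𝔬(n) : Y e_n = 0}` of `H`. -/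
def hAlg (m : ℕ) : Submodule ℝ (so m) where
  carrier := {Y | (Y : Mat m) *ᵥ Pi.single (Fin.last m) 1 = 0}
  zero_mem' := Matrix.zero_mulVec _
  add_mem' := by
    intro a b (ha : _ *ᵥ _ = _) (hb : _ *ᵥ _ = _)
    change ((a + b : so m) : Mat m) *ᵥ _ = _
    rw [Submodule.coe_add, Matrix.add_mulVec, ha, hb, add_zero]
  smul_mem' := by
    intro c a (ha : _ *ᵥ _ = _)
    change ((c • a : so m) : Mat m) *ᵥ _ = _
    rw [Submodule.coe_smul, Matrix.smul_mulVec, ha, smul_zero]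

/-- `(Y_α)` is an orthonormal basis of `𝔥`. -/
structure IsOrthonormalBasis {m : ℕ} {ι : Type*} (Y : ι → so m) : Prop where
  orthonormal : ∀ α β, (α = β → ip (Y α) (Y β) = 1) ∧ (α ≠ β → ip (Y α) (Y β) = 0)
  span : Submodule.span ℝ (Set.range Y) = hAlg m

/-- The action of `g ∈ SO(n)` on `TS` which is the tangent lift of left multiplication on `S`. -/
def leftAct {m : ℕ} (g : SO m) (x : TS m) : TS m := (g * x.1, x.2)

/-- In the left trivialization the tangent map of `leftAct g` is the identity on `TT`. -/
theorem leftAct_chart {m : ℕ} (g : SO m) (x : TS m) (p : TT m) :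
    leftAct g (chart x p) = chart (leftAct g x) p := by
  simp [leftAct, chart, mul_assoc]

/-- `Ω` is invariant under the action of `H` on `TS`, i.e. `h^* Ω = Ω` for all `h ∈ H`. -/
def IsHInvariant {m : ℕ} (Ω : TS m → TT m → TT m → ℝ) : Prop :=
  ∀ h ∈ H m, ∀ x U W, Ω (leftAct h x) U W = Ω x U W

/-- The infinitesimal generator of the lifted action of `Y` on `TS`. -/
def generator {m : ℕ} (Y : so m) (x : TS m) : TT m := (Ad x.1⁻¹ Y, 0)

theorem generator_chart {m : ℕ} (Y : so m) (x : TS m) (t : ℝ) :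
    leftAct (expSO (t • Y)) x = chart x (t • generator Y x) := by
  have hs := SO_mul_transpose x.1
  have hs' := SO_transpose_mul x.1
  have hinv : ((x.1⁻¹ : SO m) : Mat m) =
      (x.1 : Mat m)⁻¹ := by
    symm
    apply Matrix.inv_eq_left_inv
    rw [← Submonoid.coe_mul, inv_mul_cancel, Submonoid.coe_one]
  have hT : (x.1 : Mat m)⁻¹ =
      (x.1 : Mat m)ᵀ := Matrix.inv_eq_left_inv hs'
  have hU : IsUnit (x.1 : Mat m) :=
    ⟨⟨_, _, hs, hs'⟩, rfl⟩
  have e : ((t • Ad x.1⁻¹ Y : so m) : Mat m) =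
      (x.1 : Mat m)⁻¹ * ((t • Y : so m) :
        Mat m) * x.1 := by
    rw [Submodule.coe_smul, Submodule.coe_smul]
    simp only [Ad, hinv, hT, Matrix.transpose_transpose]
    rw [Matrix.mul_smul, Matrix.smul_mul]
  refine Prod.ext (Subtype.ext ?_) ?_
  · change NormedSpace.exp ((t • Y : so m) : Mat m) *
      (x.1 : Mat m) =
      x.1 * NormedSpace.exp ((t • Ad x.1⁻¹ Y : so m) : Mat m)
    rw [e, Matrix.exp_conj' _ _ hU, ← Matrix.mul_assoc, ← Matrix.mul_assoc, hT, hs,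
      Matrix.one_mul]
  · simp [leftAct, chart, generator]

/-- `J : TS → 𝔥` (with `𝔥* = 𝔥` by means of `⟨·,·⟩`) is a momentum map of the `H`-action on
`(TS, Ω)`: `i(ζ_Y) Ω = d⟨J, Y⟩` for all `Y ∈ 𝔥`. -/
structure IsMomentumMap {m : ℕ} (Ω : TS m → TT m → TT m → ℝ) (J : TS m → so m) : Prop where
  mem : ∀ x, J x ∈ hAlg m
  smooth : Smooth J
  hamiltonian : ∀ Y ∈ hAlg m, IsHamiltonianField Ω (fun x => ip (J x) Y) (generator Y)

/-! ## The Chaplygin ball and its compression -/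

/-- The inertia tensor: a symmetric positive definite operator on `(𝔰𝔬(n), ⟨·,·⟩)`. -/
structure IsInertia {m : ℕ} (I : so m →ₗ[ℝ] so m) : Prop where
  symm : ∀ u v, ip (I u) v = ip u (I v)
  pos : ∀ u, u ≠ 0 → 0 < ip (I u) u

/-- The connection form `𝒜_s(u) = -∑_{a<n} ⟨e_a, ũ e_n⟩ e_a` with `ũ = Ad(s) u`. The rolling
constraint is `x' = -𝒜_s(u)`. -/
def conn {m : ℕ} (s : SO m) (u : so m) : V m :=
  WithLp.toLp 2 fun a =>
    -((Ad s u : Mat m) *ᵥ Pi.single (Fin.last m) 1) a.castSucc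

/-- The kinetic energy metric `μ = ⟨𝕀·,·⟩ + ⟨·,·⟩_E` on `Q = S × V`. -/
def metric {m : ℕ} (I : so m →ₗ[ℝ] so m) (p q : so m × V m) : ℝ :=
  ip (I p.1) q.1 + inner ℝ p.2 q.2

/-- The horizontal lift `u ↦ (u, -𝒜_s(u))` to the constraint distribution `𝒟`. -/
def hl {m : ℕ} (s : SO m) (u : so m) : so m × V m := (u, -conn s u)

/-- The induced metric `μ₀` on `S`, by which `TS` and `T*S` are identified. -/
def metric₀ {m : ℕ} (I : so m →ₗ[ℝ] so m) (s : SO m) (u v : so m) : ℝ :=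
  metric I (hl s u) (hl s v)

/-- The compressed Hamiltonian: the kinetic energy of the horizontal lift. -/
def Hc {m : ℕ} (I : so m →ₗ[ℝ] so m) (x : TS m) : ℝ :=
  1 / 2 * metric I (hl x.1 x.2) (hl x.1 x.2)

/-- The canonical (Liouville) one-form of `T*S = TS`. -/
def liouville {m : ℕ} (I : so m →ₗ[ℝ] so m) (x : TS m) (U : TT m) : ℝ :=
  metric₀ I x.1 x.2 U.1

/-- The canonical symplectic form `Ω^S = -dθ` on `TS = T*S`. -/
def OmegaS {m : ℕ} (I : so m →ₗ[ℝ] so m) (x : TS m) (U W : TT m) : ℝ :=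
  -d₁ (liouville I) x U W

/-- `J_V ∘ hl`, where `J_V` is the momentum map of the translation action of `V` on `T*Q = TQ`;
its value at `(s, u)` is a linear functional of `z ∈ V`. -/
def JV {m : ℕ} (I : so m →ₗ[ℝ] so m) (x : TS m) (z : V m) : ℝ :=
  metric I (hl x.1 x.2) (0, z)

/-- The non-holonomic two-form `Ω_nh = Ω^S - ⟨J_V ∘ hl, d𝒜⟩`. -/
def OmegaNh {m : ℕ} (I : so m →ₗ[ℝ] so m) (x : TS m) (U W : TT m) : ℝ :=
  OmegaS I x U W - JV I x (dS conn x.1 U.1 W.1)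

/-! ## The truncated form -/

section Truncation

variable {m : ℕ} {ι : Type*} [Fintype ι]

/-- The one-forms `ρ^α` on `S`, `ρ^α_s(u) = ⟨Y_α, Ad(s) u⟩`: together with the `η^a` belonging to
an orthonormal basis of `𝔥^⊥` they are the co-frame dual to the right invariant frame. -/
def rho (Y : ι → so m) (α : ι) (s : SO m) (u : so m) : ℝ := ip (Y α) (Ad s u)

/-- The standard `H`-connection `ω = ∑ ρ^α ⊗ Y_α` on `SO(n) → S^{n-1}`. -/
def omega (Y : ι → so m) (s : SO m) (u : so m) : so m := ∑ α, rho Y α s u • Y α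

/-- The curvature `Curv^ω = dω - (1/2)[ω, ω]`, where `[ω, ω](v, w) = 2 [ω(v), ω(w)]`. -/
def Curv (Y : ι → so m) (s : SO m) (v w : so m) : so m :=
  dS (omega Y) s v w - lie (omega Y s v) (omega Y s w)

/-- `L = ∑ l_α Y_α`, where `l_α(s, u) = ρ^α_s(u)`. -/
def L (Y : ι → so m) (x : TS m) : so m := ∑ α, rho Y α x.1 x.2 • Y α

/-- `J_H = ∑ l̃_α Y_α`, where `l̃_α(s, u) = ρ^α_s(𝕀 u)`. -/
def JH (I : so m →ₗ[ℝ] so m) (Y : ι → so m) (x : TS m) : so m :=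
  ∑ α, rho Y α x.1 (I x.2) • Y α

/-- The truncated form `Ω̃ = Ω^S - ⟨L, Curv^ω⟩`. -/
def OmegaTilde (I : so m →ₗ[ℝ] so m) (Y : ι → so m) (x : TS m) (U W : TT m) : ℝ :=
  OmegaS I x U W - ip (L Y x) (Curv Y x.1 U.1 W.1)

end Truncation

end Chaplygin

end

/-! Write `P` (`perp`) for the orthogonal projection of 𝔰𝔬(n) onto 𝔥^⊥, and move every vector to the
space frame by Ad(s): a = Ad(s)u, v̂ = Ad(s)v, ŵ = Ad(s)w. The map "last column" turns the Euclidean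
product into ⟨P·,·⟩, so μ₀(u,v) = ⟨𝕀u,v⟩ + ⟨P a, v̂⟩. A one-form T(Ad(s)v), with T linear, has
exterior derivative T[v̂,ŵ] (`dS_linear_Ad`). Applied to 𝒜 and ω, this and the symmetric-pair
relations for 𝔥 ⊕ 𝔥^⊥ give Ω_nh = Ω^S + ⟨P a,[v̂,ŵ]⟩ and Ω̃ = Ω^S − ⟨a,[P v̂,P ŵ]⟩.

Both forms change Ω^S by a semi-basic term, which does not affect non-degeneracy. The exterior
derivative of Ω̃ on two base directions and one fibre direction c is −⟨ĉ,[P v̂,P ŵ]⟩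
(`d₂_OmegaTilde_semibasic`), and for n ≥ 3 the space 𝔥^⊥ is not abelian, so Ω̃ is not closed.
Invariance holds because Ad(h), h ∈ H, commutes with `P`.

The field X_nh is of second order: its base component is u. For v = u the two semi-basic terms
agree, because [a,P a] = [a − P a,P a] lies in 𝔥^⊥ (`OmegaNh_eq_OmegaTilde_of_fst`); so Ω̃ may
replace Ω_nh in the equation of motion.

A generator of H has v̂ = Z ∈ 𝔥, so P v̂ = 0: the curvature term drops out, the terms from the
translational energy cancel by ad-invariance, and only d⟨Ad(s)𝕀u, Z⟩ is left. -/

noncomputable section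

namespace Chaplygin

/-! ### Invariant algebra of 𝔰𝔬(n) and the symmetric pair 𝔥 ⊕ 𝔥^⊥. -/

section Algebra

variable {m : ℕ}

theorem lie_add (a b c : so m) : lie a (b + c) = lie a b + lie a c :=
  Subtype.ext (by simp only [lie, Submodule.coe_add]; noncomm_ring)

theorem add_lie (a b c : so m) : lie (a + b) c = lie a c + lie b c :=
  Subtype.ext (by simp only [lie, Submodule.coe_add]; noncomm_ring)

theorem lie_smul (r : ℝ) (a b : so m) : lie a (r • b) = r • lie a b :=
  Subtype.ext (by simp [lie, smul_sub])

theorem smul_lie (r : ℝ) (a b : so m) : lie (r • a) b = r • lie a b :=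
  Subtype.ext (by simp [lie, smul_sub])

theorem lie_neg_swap (a b : so m) : lie a b = -lie b a :=
  Subtype.ext (by simp [lie])

theorem lie_zero (a : so m) : lie a 0 = 0 :=
  Subtype.ext (by simp [lie])

theorem zero_lie (a : so m) : lie 0 a = 0 :=
  Subtype.ext (by simp [lie])

theorem lie_self (a : so m) : lie a a = 0 :=
  Subtype.ext (by simp [lie])

theorem ip_comm (a b : so m) : ip a b = ip b a := by
  simp only [ip]
  rw [Matrix.trace_mul_comm]

theorem ip_add (a b c : so m) : ip a (b + c) = ip a b + ip a c := by
  simp only [ip, Submodule.coe_add, Matrix.mul_add, Matrix.trace_add]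
  ring

theorem add_ip (a b c : so m) : ip (a + b) c = ip a c + ip b c := by
  simp only [ip_comm _ c, ip_add]

theorem ip_smul (r : ℝ) (a b : so m) : ip a (r • b) = r * ip a b := by
  simp only [ip, Submodule.coe_smul, Matrix.mul_smul, Matrix.trace_smul, smul_eq_mul]
  ring

theorem smul_ip (r : ℝ) (a b : so m) : ip (r • a) b = r * ip a b := by
  simp only [ip_comm _ b, ip_smul]

theorem ip_zero (a : so m) : ip a 0 = 0 := by
  simp [ip]

theorem zero_ip (a : so m) : ip 0 a = 0 := by
  simp [ip]

theorem ip_neg (a b : so m) : ip a (-b) = -ip a b := by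
  simp [ip]

theorem neg_ip (a b : so m) : ip (-a) b = -ip a b := by
  simp [ip]

theorem ip_sub (a b c : so m) : ip a (b - c) = ip a b - ip a c := by
  rw [sub_eq_add_neg, ip_add, ip_neg, sub_eq_add_neg]

theorem sub_ip (a b c : so m) : ip (a - b) c = ip a c - ip b c := by
  rw [sub_eq_add_neg, add_ip, neg_ip, sub_eq_add_neg]

/-- The inner product `⟨·,·⟩` is invariant under the adjoint representation of `𝔰𝔬(n)`. -/
theorem ip_lie_left (a b c : so m) : ip (lie a b) c = ip a (lie b c) := by
  simp only [ip, lie, sub_mul, mul_sub, Matrix.trace_sub]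
  rw [Matrix.mul_assoc, Matrix.mul_assoc, Matrix.trace_mul_comm (b : Mat m), Matrix.mul_assoc]

theorem ip_self_pos (a : so m) (ha : a ≠ 0) : 0 < ip a a := by
  have h : ip a a = 1 / 2 * Matrix.trace ((a : Mat m)ᵀ * (a : Mat m)) := by
    rw [so_transpose, neg_mul, Matrix.trace_neg, ip]
    ring
  have h0 : (a : Mat m) ≠ 0 := fun h => ha (Subtype.ext h)
  have h1 : 0 ≤ Matrix.trace ((a : Mat m)ᵀ * (a : Mat m)) :=
    (Matrix.posSemidef_conjTranspose_mul_self (a : Mat m)).trace_nonneg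
  have h2 : Matrix.trace ((a : Mat m)ᵀ * (a : Mat m)) ≠ 0 := fun h =>
    h0 (Matrix.trace_conjTranspose_mul_self_eq_zero_iff.1 h)
  rw [h]
  positivity

theorem Ad_add (s : SO m) (a b : so m) : Ad s (a + b) = Ad s a + Ad s b :=
  Subtype.ext (by simp [Ad, mul_add, add_mul])

theorem Ad_smul (s : SO m) (r : ℝ) (a : so m) : Ad s (r • a) = r • Ad s a :=
  Subtype.ext (by simp [Ad])

theorem Ad_neg (s : SO m) (a : so m) : Ad s (-a) = -Ad s a :=
  Subtype.ext (by simp [Ad])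

theorem Ad_zero (s : SO m) : Ad s 0 = 0 :=
  Subtype.ext (by simp [Ad])

theorem Ad_mul (s t : SO m) (a : so m) : Ad (s * t) a = Ad s (Ad t a) :=
  Subtype.ext (by simp [Ad, Matrix.mul_assoc])

theorem Ad_one (a : so m) : Ad 1 a = a :=
  Subtype.ext (by simp [Ad])

theorem Ad_inv_cancel (s : SO m) (a : so m) : Ad s (Ad s⁻¹ a) = a := by
  rw [← Ad_mul, mul_inv_cancel, Ad_one]

theorem Ad_lie (s : SO m) (a b : so m) : Ad s (lie a b) = lie (Ad s a) (Ad s b) := by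
  refine Subtype.ext ?_
  have h : ∀ X Y : Mat m, (s : Mat m) * X * (s : Mat m)ᵀ * ((s : Mat m) * Y * (s : Mat m)ᵀ) =
      (s : Mat m) * (X * Y) * (s : Mat m)ᵀ := fun X Y => by
    calc _ = (s : Mat m) * X * ((s : Mat m)ᵀ * (s : Mat m)) * Y * (s : Mat m)ᵀ := by
          simp only [Matrix.mul_assoc]
      _ = _ := by rw [SO_transpose_mul]; simp only [Matrix.mul_assoc, Matrix.mul_one]
  simp only [Ad, lie, h, mul_sub, sub_mul]

theorem ip_Ad (s : SO m) (a b : so m) : ip (Ad s a) (Ad s b) = ip a b := by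
  simp only [ip, Ad]
  congr 1
  calc _ = Matrix.trace ((s : Mat m) * (a : Mat m) * ((s : Mat m)ᵀ * (s : Mat m)) * (b : Mat m) * (s : Mat m)ᵀ) := by
        simp only [Matrix.mul_assoc]
    _ = _ := by
        rw [SO_transpose_mul, Matrix.mul_one, Matrix.trace_mul_comm]
        simp only [← Matrix.mul_assoc, SO_transpose_mul, Matrix.one_mul]

/-- The orthogonal projection of `ℝⁿ` onto the line spanned by `e_n`. -/
def lastProj (m : ℕ) : Mat m := Matrix.single (Fin.last m) (Fin.last m) 1

theorem lastProj_transpose : (lastProj m)ᵀ = lastProj m := by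
  simp [lastProj]

theorem lastProj_mul_self : lastProj m * lastProj m = lastProj m := by
  simp [lastProj]

theorem lastProj_mul_mul_lastProj (X : Mat m) :
    lastProj m * X * lastProj m = X (Fin.last m) (Fin.last m) • lastProj m := by
  simp [lastProj, Matrix.single_mul_mul_single]

theorem so_apply_self (X : so m) (i : Fin (m + 1)) : (X : Mat m) i i = 0 := by
  have h := congrFun (congrFun (so_transpose X) i) i
  simp only [Matrix.transpose_apply, Matrix.neg_apply] at h
  linarith

theorem lastProj_mul_so_mul_lastProj (X : so m) :
    lastProj m * (X : Mat m) * lastProj m = 0 := by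
  rw [lastProj_mul_mul_lastProj, so_apply_self, zero_smul]

/-- The orthogonal projection of `𝔰𝔬(n)` onto `𝔥^⊥`. -/
def perp : so m →ₗ[ℝ] so m where
  toFun X := ⟨X * lastProj m + lastProj m * X, by
    change (_ + _)ᵀ = -(_ + _)
    rw [Matrix.transpose_add, Matrix.transpose_mul, Matrix.transpose_mul, so_transpose,
      lastProj_transpose]
    noncomm_ring⟩
  map_add' X Z := Subtype.ext (by simp only [Submodule.coe_add]; noncomm_ring)
  map_smul' r X := Subtype.ext (by simp)

theorem coe_perp (X : so m) : (perp X : Mat m) = X * lastProj m + lastProj m * X := rfl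

theorem perp_perp (X : so m) : perp (perp X) = perp X := by
  refine Subtype.ext ?_
  have h := lastProj_mul_so_mul_lastProj X
  have h2 := lastProj_mul_self (m := m)
  simp only [coe_perp, add_mul, mul_add, ← Matrix.mul_assoc, h2]
  simp only [Matrix.mul_assoc, h2]
  rw [← Matrix.mul_assoc, h]
  simp

theorem ip_perp_left (X Z : so m) : ip (perp X) Z = ip X (perp Z) := by
  simp only [ip, coe_perp, add_mul, mul_add, Matrix.trace_add]
  rw [Matrix.mul_assoc, Matrix.mul_assoc, Matrix.trace_mul_comm (lastProj m), Matrix.mul_assoc]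
  ring

theorem mul_lastProj_eq_zero_iff (X : Mat m) :
    X * lastProj m = 0 ↔ X *ᵥ Pi.single (Fin.last m) 1 = 0 := by
  have h : ∀ i j, (X * lastProj m) i j = if j = Fin.last m then X i (Fin.last m) else 0 := by
    intro i j
    simp only [lastProj, Matrix.mul_apply, Matrix.single_apply]
    by_cases hj : j = Fin.last m
    · subst hj; simp
    · simp [hj, Ne.symm hj]
  constructor
  · intro h0
    ext i
    have := congrFun (congrFun h0 i) (Fin.last m)
    rw [h] at this
    simpa using this
  · intro h0
    ext i j
    have := congrFun h0 i
    rw [h]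
    simp at this
    simp [this]

theorem mem_hAlg_iff_mul_lastProj (X : so m) : X ∈ hAlg m ↔ (X : Mat m) * lastProj m = 0 :=
  (mul_lastProj_eq_zero_iff _).symm

theorem lastProj_mul_of_mem_hAlg {X : so m} (hX : X ∈ hAlg m) : lastProj m * (X : Mat m) = 0 := by
  have h := congrArg Matrix.transpose ((mem_hAlg_iff_mul_lastProj X).1 hX)
  rw [Matrix.transpose_mul, so_transpose, lastProj_transpose] at h
  simpa using h

theorem mem_hAlg_iff_perp (X : so m) : X ∈ hAlg m ↔ perp X = 0 := by
  constructor
  · intro h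
    refine Subtype.ext ?_
    rw [coe_perp, (mem_hAlg_iff_mul_lastProj X).1 h, lastProj_mul_of_mem_hAlg h]
    simp
  · intro h
    rw [mem_hAlg_iff_mul_lastProj]
    have h1 := congrArg (fun Z : so m => (Z : Mat m) * lastProj m) h
    simp only [coe_perp, add_mul, Matrix.mul_assoc, lastProj_mul_self] at h1
    rw [← Matrix.mul_assoc, lastProj_mul_so_mul_lastProj] at h1
    simpa using h1

theorem sub_perp_mem_hAlg (X : so m) : X - perp X ∈ hAlg m := by
  rw [mem_hAlg_iff_perp, map_sub, perp_perp, sub_self]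

/-- `[𝔥, 𝔥^⊥] ⊆ 𝔥^⊥`, together with `[𝔥, 𝔥] ⊆ 𝔥`. -/
theorem perp_lie_of_mem_hAlg {X : so m} (hX : X ∈ hAlg m) (Z : so m) :
    perp (lie X Z) = lie X (perp Z) := by
  refine Subtype.ext ?_
  have h1 := (mem_hAlg_iff_mul_lastProj X).1 hX
  have h2 := lastProj_mul_of_mem_hAlg hX
  simp only [coe_perp, lie, sub_mul, mul_sub, add_mul, mul_add]
  simp only [Matrix.mul_assoc, h1]
  simp only [← Matrix.mul_assoc, h1, h2]
  simp [sub_eq_add_neg]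

/-- `[𝔥^⊥, 𝔥^⊥] ⊆ 𝔥`. -/
theorem perp_lie_perp_perp (X Z : so m) : perp (lie (perp X) (perp Z)) = 0 := by
  rw [← mem_hAlg_iff_perp, mem_hAlg_iff_mul_lastProj]
  have hX := lastProj_mul_so_mul_lastProj X
  have hZ := lastProj_mul_so_mul_lastProj Z
  have h2 := lastProj_mul_self (m := m)
  have key : ∀ A B : so m, lastProj m * (A : Mat m) * lastProj m = 0 →
      lastProj m * (B : Mat m) * lastProj m = 0 →
      (perp A : Mat m) * (perp B : Mat m) * lastProj m =
        lastProj m * ((A : Mat m) * B) * lastProj m := by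
    intro A B hA hB
    calc (perp A : Mat m) * (perp B : Mat m) * lastProj m
        = (A : Mat m) * (lastProj m * B * lastProj m) * 1
          + (A : Mat m) * (lastProj m * lastProj m * B * lastProj m)
          + lastProj m * A * B * (lastProj m * lastProj m)
          + (lastProj m * A * lastProj m) * B * lastProj m := by
          simp only [coe_perp, hA, hB]
          simp only [add_mul, mul_add, ← Matrix.mul_assoc, h2]
          simp only [Matrix.mul_assoc, h2]
          simp only [← Matrix.mul_assoc, hB]
          simp [Matrix.mul_assoc]
      _ = _ := by
          rw [h2, hA, hB]
          simp [Matrix.mul_assoc]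
  -- Transposition turns XZ into ZX for skew X and Z, so the two products have the same (n,n) entry,
  -- which is all that the projections retain.
  have hc : lastProj m * ((X : Mat m) * Z) * lastProj m =
      lastProj m * ((Z : Mat m) * X) * lastProj m := by
    rw [lastProj_mul_mul_lastProj, lastProj_mul_mul_lastProj]
    congr 1
    have h := congrFun (congrFun (Matrix.transpose_mul (X : Mat m) Z) (Fin.last m)) (Fin.last m)
    simpa [so_transpose] using h
  simp only [lie, sub_mul]
  rw [key X Z hX hZ, key Z X hZ hX, hc, sub_self]

/-- Transposition shows that the two halves of `perp X` contribute equally to the trace, which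
cancels the factor 1/2. This links the translational energy to `perp`. -/
theorem ip_perp_eq_dotProduct (X Z : so m) :
    ip (perp X) Z = ((X : Mat m) *ᵥ Pi.single (Fin.last m) 1) ⬝ᵥ
      ((Z : Mat m) *ᵥ Pi.single (Fin.last m) 1) := by
  have h : Matrix.trace (lastProj m * (X : Mat m) * (Z : Mat m)) =
      Matrix.trace ((X : Mat m) * lastProj m * (Z : Mat m)) := by
    rw [← Matrix.trace_transpose]
    simp only [Matrix.transpose_mul, so_transpose, lastProj_transpose]
    rw [Matrix.neg_mul, Matrix.neg_mul, Matrix.mul_neg, neg_neg, Matrix.trace_mul_comm]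
  have h' : Matrix.trace ((X : Mat m) * lastProj m * (Z : Mat m)) =
      -∑ i, (X : Mat m) i (Fin.last m) * (Z : Mat m) i (Fin.last m) := by
    have hZ : ∀ i, (Z : Mat m) (Fin.last m) i = -(Z : Mat m) i (Fin.last m) := fun i =>
      congrFun (congrFun (so_transpose Z) i) (Fin.last m)
    rw [Matrix.mul_assoc, Matrix.trace, ← Finset.sum_neg_distrib]
    refine Finset.sum_congr rfl fun i _ => ?_
    rw [Matrix.diag_apply, Matrix.mul_apply, Finset.sum_eq_single (Fin.last m)]
    · simp [lastProj, hZ]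
    · intro j _ hj
      simp [lastProj, hj]
    · simp
  simp only [ip, coe_perp, add_mul, Matrix.trace_add, h, h']
  simp only [Matrix.mulVec_single_one, dotProduct, Matrix.col_apply]
  ring

/-- For `n ≥ 3` the space `𝔥^⊥` is not an abelian subalgebra. -/
theorem exists_lie_perp_ne_zero (hm : 3 ≤ m + 1) :
    ∃ a b : so m, lie (perp a) (perp b) ≠ 0 := by
  let l := Fin.last m
  -- For n ≥ 3 the indices 0 and 1 both differ from the last one. The matrices E_kl − E_lk with k =
  -- i, j lie in 𝔥^⊥, and the (i,j) entry of their bracket is −1.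
  let i : Fin (m + 1) := ⟨0, by omega⟩
  let j : Fin (m + 1) := ⟨1, by omega⟩
  have hil : i ≠ l := fun h => by have := congrArg Fin.val h; simp [i, l] at this; omega
  have hjl : j ≠ l := fun h => by have := congrArg Fin.val h; simp [j, l] at this; omega
  have hij : i ≠ j := fun h => by have := congrArg Fin.val h; simp [i, j] at this
  let skew : Fin (m + 1) → so m := fun k =>
    ⟨Matrix.single k l 1 - Matrix.single l k 1, by
      change (_ - _)ᵀ = -(_ - _)
      simp⟩
  have hperp : ∀ k, k ≠ l → perp (skew k) = skew k := by
    intro k hk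
    refine Subtype.ext ?_
    have hk' : k ≠ Fin.last m := hk
    simp [coe_perp, skew, lastProj, add_mul, mul_add, hk', hk'.symm, l, sub_eq_add_neg]
  refine ⟨skew i, skew j, fun h => ?_⟩
  rw [hperp i hil, hperp j hjl] at h
  have h1 := congrArg (fun Z : so m => (Z : Mat m) i j) h
  simp [lie, skew, sub_mul, mul_sub, hil, hjl, hil.symm, hjl.symm, hij, hij.symm] at h1

end Algebra

/-! ### Calculus along left invariant directions. -/

section Derivatives

variable {m : ℕ}

attribute [local instance] Matrix.frobeniusNormedRing Matrix.frobeniusNormedAlgebra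

/-- The skew-symmetric part of a matrix. -/
def skewPart (m : ℕ) : Mat m →ₗ[ℝ] so m where
  toFun X := ⟨(1 / 2 : ℝ) • (X - Xᵀ), by
    change (_ • (_ - _))ᵀ = -(_ • (_ - _))
    simp [smul_sub]⟩
  map_add' X Z := Subtype.ext (by
    simp only [Matrix.transpose_add, Submodule.coe_add, ← smul_add]
    congr 1
    abel)
  map_smul' r X := Subtype.ext (by
    simp only [Matrix.transpose_smul, Submodule.coe_smul, RingHom.id_apply, ← smul_sub]
    rw [smul_comm])

theorem skewPart_coe (X : so m) : skewPart m (X : Mat m) = X := by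
  refine Subtype.ext ?_
  change (1 / 2 : ℝ) • ((X : Mat m) - (X : Mat m)ᵀ) = X
  rw [so_transpose, sub_neg_eq_add, ← two_smul ℝ (X : Mat m), smul_smul]
  norm_num

/-- `skewPart` is a continuous linear left inverse of the inclusion into matrices, so
differentiability can be checked there, where products and the exponential live. -/
theorem hasDerivAt_of_coe {f : ℝ → so m} {f' : so m} {t : ℝ}
    (h : HasDerivAt (fun t => (f t : Mat m)) (f' : Mat m) t) : HasDerivAt f f' t := by
  have h1 : HasDerivAt (fun t => skewPart m (f t : Mat m)) (skewPart m (f' : Mat m)) t :=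
    (skewPart m).toContinuousLinearMap.hasFDerivAt.comp_hasDerivAt t h
  simpa only [skewPart_coe] using h1

theorem contDiff_of_coe {E : Type*} [NormedAddCommGroup E] [NormedSpace ℝ E] {f : E → so m}
    (h : ContDiff ℝ ∞ (fun p => (f p : Mat m))) : ContDiff ℝ ∞ f := by
  have h1 : ContDiff ℝ ∞ (fun p => skewPart m (f p : Mat m)) :=
    (skewPart m).toContinuousLinearMap.contDiff.comp h
  simpa only [skewPart_coe] using h1

theorem contDiff_coe_so : ContDiff ℝ ∞ (fun a : so m => (a : Mat m)) :=
  (soSubmodule m).subtypeL.contDiff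

theorem hasDerivAt_coe_so {f : ℝ → so m} {f' : so m} {t : ℝ} (h : HasDerivAt f f' t) :
    HasDerivAt (fun t => (f t : Mat m)) (f' : Mat m) t :=
  (soSubmodule m).subtypeL.hasFDerivAt.comp_hasDerivAt t h

theorem hasDerivAt_transpose {f : ℝ → Mat m} {f' : Mat m} {t : ℝ} (h : HasDerivAt f f' t) :
    HasDerivAt (fun t => (f t)ᵀ) f'ᵀ t :=
  (Matrix.transposeLinearEquiv (Fin (m + 1)) (Fin (m + 1)) ℝ
    ℝ).toLinearMap.toContinuousLinearMap.hasFDerivAt.comp_hasDerivAt t h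

theorem contDiff_transpose : ContDiff ℝ ∞ (fun X : Mat m => Xᵀ) :=
  (Matrix.transposeLinearEquiv (Fin (m + 1)) (Fin (m + 1)) ℝ
    ℝ).toLinearMap.toContinuousLinearMap.contDiff

theorem contDiff_exp_so : ContDiff ℝ ∞ (fun a : so m => NormedSpace.exp (a : Mat m)) := by
  have h : ContDiff ℝ ∞ (NormedSpace.exp : Mat m → Mat m) :=
    contDiff_iff_contDiffAt.2 fun x => (NormedSpace.exp_analytic (𝕂 := ℝ) x).contDiffAt
  exact h.comp contDiff_coe_so

theorem hasDerivAt_expSO (v : so m) :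
    HasDerivAt (fun t : ℝ => (expSO (t • v) : Mat m)) (v : Mat m) 0 := by
  have h := hasDerivAt_exp_smul_const (𝕂 := ℝ) (v : Mat m) (0 : ℝ)
  refine (h.congr_of_eventuallyEq (.of_forall fun t => rfl)).congr_deriv ?_
  rw [zero_smul, NormedSpace.exp_zero, one_mul]

theorem expSO_zero : expSO (0 : so m) = 1 :=
  Subtype.ext (by simp [expSO])

/-- The derivative of the adjoint action along a left invariant vector field. -/
theorem hasDerivAt_Ad (s : SO m) (v : so m) {f : ℝ → so m} {f' : so m} (hf : HasDerivAt f f' 0) :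
    HasDerivAt (fun t : ℝ => Ad (s * expSO (t • v)) (f t)) (Ad s (lie v (f 0) + f')) 0 := by
  refine hasDerivAt_of_coe ?_
  have h1 := hasDerivAt_expSO v
  have h2 := (((h1.mul (hasDerivAt_coe_so hf)).mul (hasDerivAt_transpose h1)).const_mul
    (s : Mat m)).mul_const (s : Mat m)ᵀ
  refine (h2.congr_of_eventuallyEq (.of_forall fun t => ?_)).congr_deriv ?_
  · simp [Ad, Matrix.mul_assoc]
  · simp only [Pi.mul_apply, zero_smul, expSO_zero, Submonoid.coe_one, Matrix.transpose_one,
      so_transpose, Ad, lie, Submodule.coe_add]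
    noncomm_ring

theorem hasDerivAt_ip {f g : ℝ → so m} {f' g' : so m} {t : ℝ} (hf : HasDerivAt f f' t)
    (hg : HasDerivAt g g' t) :
    HasDerivAt (fun t => ip (f t) (g t)) (ip f' (g t) + ip (f t) g') t := by
  have h := ((Matrix.traceLinearMap (Fin (m + 1)) ℝ
    ℝ).toContinuousLinearMap.hasFDerivAt.comp_hasDerivAt t
    ((hasDerivAt_coe_so hf).mul (hasDerivAt_coe_so hg))).const_mul (-(1 / 2))
  refine (h.congr_of_eventuallyEq (.of_forall fun t => rfl)).congr_deriv ?_
  change -(1 / 2) * Matrix.trace ((f' : Mat m) * (g t : Mat m) + (f t : Mat m) * (g' : Mat m)) = _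
  rw [Matrix.trace_add, mul_add]
  rfl

theorem hasDerivAt_linear {F G : Type*} [NormedAddCommGroup F] [NormedSpace ℝ F]
    [FiniteDimensional ℝ F] [NormedAddCommGroup G] [NormedSpace ℝ G] (T : F →ₗ[ℝ] G) {f : ℝ → F}
    {f' : F} {t : ℝ} (hf : HasDerivAt f f' t) : HasDerivAt (fun t => T (f t)) (T f') t :=
  T.toContinuousLinearMap.hasFDerivAt.comp_hasDerivAt t hf

theorem contDiff_Ad {E : Type*} [NormedAddCommGroup E] [NormedSpace ℝ E] (s : SO m)
    {f g : E → so m} (hf : ContDiff ℝ ∞ f) (hg : ContDiff ℝ ∞ g) :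
    ContDiff ℝ ∞ (fun p => Ad (s * expSO (f p)) (g p)) := by
  refine contDiff_of_coe ?_
  have h1 : ContDiff ℝ ∞ (fun p => (s : Mat m) * (expSO (f p) : Mat m)) :=
    contDiff_const.mul (contDiff_exp_so.comp hf)
  exact (h1.mul (contDiff_coe_so.comp hg)).mul (contDiff_transpose.comp h1)

theorem contDiff_lie {E : Type*} [NormedAddCommGroup E] [NormedSpace ℝ E]
    {f g : E → so m} (hf : ContDiff ℝ ∞ f) (hg : ContDiff ℝ ∞ g) :
    ContDiff ℝ ∞ (fun p => lie (f p) (g p)) := by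
  refine contDiff_of_coe ?_
  have h1 := contDiff_coe_so.comp hf
  have h2 := contDiff_coe_so.comp hg
  exact (h1.mul h2).sub (h2.mul h1)

theorem contDiff_ip {E : Type*} [NormedAddCommGroup E] [NormedSpace ℝ E]
    {f g : E → so m} (hf : ContDiff ℝ ∞ f) (hg : ContDiff ℝ ∞ g) :
    ContDiff ℝ ∞ (fun p => ip (f p) (g p)) :=
  contDiff_const.mul ((Matrix.traceLinearMap (Fin (m + 1)) ℝ
    ℝ).toContinuousLinearMap.contDiff.comp
    ((contDiff_coe_so.comp hf).mul (contDiff_coe_so.comp hg)))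

end Derivatives

/-! ### Closed formulas for the two-forms in the space frame. -/

section Formulas

variable {m : ℕ}

/-- The first `n - 1` entries of the last column of a skew-symmetric matrix. -/
def lastColumn : so m →ₗ[ℝ] V m where
  toFun X := WithLp.toLp 2 fun a => ((X : Mat m) *ᵥ Pi.single (Fin.last m) 1) a.castSucc
  map_add' X Z := by
    ext a
    simp
  map_smul' r X := by
    ext a
    simp

/-- The omitted n-th entry is a diagonal entry of a skew matrix, so truncating the column loses
nothing. -/
theorem inner_lastColumn (X Z : so m) :
    inner ℝ (lastColumn X) (lastColumn Z) = ip (perp X) Z := by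
  rw [ip_perp_eq_dotProduct]
  simp only [dotProduct, Fin.sum_univ_castSucc, PiLp.inner_apply, lastColumn]
  simp [so_apply_self, mul_comm]

theorem conn_eq_lastColumn : (conn : SO m → so m → V m) = fun s u => (-lastColumn) (Ad s u) :=
  rfl

theorem metric₀_apply (I : so m →ₗ[ℝ] so m) (s : SO m) (u v : so m) :
    metric₀ I s u v = ip (I u) v + ip (perp (Ad s u)) (Ad s v) := by
  simp only [metric₀, metric, hl, conn_eq_lastColumn, LinearMap.neg_apply, neg_neg,
    inner_lastColumn]

theorem Hc_apply (I : so m →ₗ[ℝ] so m) (x : TS m) :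
    Hc I x = 1 / 2 * (ip (I x.2) x.2 + ip (perp (Ad x.1 x.2)) (Ad x.1 x.2)) := by
  rw [← metric₀_apply]
  rfl

theorem JV_apply (I : so m →ₗ[ℝ] so m) (x : TS m) (X : so m) :
    JV I x (lastColumn X) = ip (perp (Ad x.1 x.2)) X := by
  simp [JV, metric, hl, conn_eq_lastColumn, inner_lastColumn, ip_zero]

theorem chart_zero_smul (x : TS m) (U : TT m) : chart x ((0 : ℝ) • U) = x := by
  simp [chart, expSO_zero]

theorem hasDerivAt_chart_snd (x : TS m) (U : TT m) :
    HasDerivAt (fun t : ℝ => (chart x (t • U)).2) U.2 0 := by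
  have h := ((hasDerivAt_id (0 : ℝ)).smul_const U.2).const_add x.2
  rw [one_smul] at h
  exact h

theorem hasDerivAt_Ad_chart_const (x : TS m) (U : TT m) (a : so m) :
    HasDerivAt (fun t : ℝ => Ad (chart x (t • U)).1 a) (lie (Ad x.1 U.1) (Ad x.1 a)) 0 := by
  have h := hasDerivAt_Ad x.1 U.1 (hasDerivAt_const (0 : ℝ) a)
  rw [add_zero, Ad_lie] at h
  exact h

theorem hasDerivAt_Ad_chart (x : TS m) (U : TT m) {f : ℝ → so m} {f' : so m}
    (hf : HasDerivAt f f' 0) :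
    HasDerivAt (fun t : ℝ => Ad (chart x (t • U)).1 (f t))
      (lie (Ad x.1 U.1) (Ad x.1 (f 0)) + Ad x.1 f') 0 := by
  have h := hasDerivAt_Ad x.1 U.1 hf
  rw [Ad_add, Ad_lie] at h
  exact h

theorem hasDerivAt_Ad_chart_snd (x : TS m) (U : TT m) :
    HasDerivAt (fun t : ℝ => Ad (chart x (t • U)).1 (chart x (t • U)).2)
      (lie (Ad x.1 U.1) (Ad x.1 x.2) + Ad x.1 U.2) 0 := by
  simpa only [chart_zero_smul] using hasDerivAt_Ad_chart x U (hasDerivAt_chart_snd x U)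

theorem D_eq_of_hasDerivAt {F : Type*} [NormedAddCommGroup F] [NormedSpace ℝ F] {f : TS m → F}
    {x : TS m} {U : TT m} {f' : F} (h : HasDerivAt (fun t : ℝ => f (chart x (t • U))) f' 0) :
    D f x U = f' :=
  h.deriv

/-- The Maurer–Cartan equation of the right invariant form: each of the two derivatives contributes
T[Ad(s)v, Ad(s)w], and the bracket term removes one copy. -/
theorem dS_linear_Ad {F : Type*} [NormedAddCommGroup F] [NormedSpace ℝ F] (T : so m →ₗ[ℝ] F)
    (s : SO m) (v w : so m) :
    dS (fun s u => T (Ad s u)) s v w = T (lie (Ad s v) (Ad s w)) := by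
  have h : ∀ a b : so m, DS (fun s' => T (Ad s' b)) s a = T (lie (Ad s a) (Ad s b)) := fun a b =>
    (hasDerivAt_linear T (hasDerivAt_Ad_chart_const (s, 0) (a, 0) b)).deriv
  rw [dS, h, h, Ad_lie, lie_neg_swap (Ad s w), map_neg]
  abel

theorem D_liouville (I : so m →ₗ[ℝ] so m) (x : TS m) (U W : TT m) :
    D (fun y => liouville I y W) x U = metric₀ I x.1 U.2 W.1
      + ip (perp (lie (Ad x.1 U.1) (Ad x.1 x.2))) (Ad x.1 W.1)
      + ip (perp (Ad x.1 x.2)) (lie (Ad x.1 U.1) (Ad x.1 W.1)) := by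
  simp only [liouville, metric₀_apply]
  rw [D_eq_of_hasDerivAt ((hasDerivAt_ip (hasDerivAt_linear I (hasDerivAt_chart_snd x U))
    (hasDerivAt_const _ W.1)).add (hasDerivAt_ip
      (hasDerivAt_linear perp (hasDerivAt_Ad_chart_snd x U))
      (hasDerivAt_Ad_chart_const x U W.1)))]
  simp only [chart_zero_smul, ip_zero, map_add, add_ip]
  ring

/-- The inertia part of μ₀ is left invariant and meets base directions only through the bracket. The
`perp` part also varies with s, whence the opposite sign of its bracket term and the two last terms.
-/
theorem OmegaS_apply (I : so m →ₗ[ℝ] so m) (x : TS m) (U W : TT m) :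
    OmegaS I x U W = metric₀ I x.1 W.2 U.1 - metric₀ I x.1 U.2 W.1 + ip (I x.2) (lie U.1 W.1)
      - ip (perp (Ad x.1 x.2)) (lie (Ad x.1 U.1) (Ad x.1 W.1))
      - ip (lie (Ad x.1 U.1) (Ad x.1 x.2)) (perp (Ad x.1 W.1))
      + ip (lie (Ad x.1 W.1) (Ad x.1 x.2)) (perp (Ad x.1 U.1)) := by
  rw [OmegaS, d₁, D_liouville, D_liouville]
  simp only [liouville, bracketTT, metric₀_apply, Ad_lie, ip_perp_left (lie _ _)]
  rw [lie_neg_swap (Ad x.1 W.1) (Ad x.1 U.1), ip_neg]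
  ring

theorem OmegaNh_apply (I : so m →ₗ[ℝ] so m) (x : TS m) (U W : TT m) :
    OmegaNh I x U W = OmegaS I x U W
      + ip (perp (Ad x.1 x.2)) (lie (Ad x.1 U.1) (Ad x.1 W.1)) := by
  rw [OmegaNh, conn_eq_lastColumn, dS_linear_Ad, LinearMap.neg_apply, ← map_neg, JV_apply, ip_neg,
    sub_neg_eq_add]

theorem IsOrthonormalBasis.mem {ι : Type*} {Y : ι → so m} (hY : IsOrthonormalBasis Y)
    (α : ι) : Y α ∈ hAlg m :=
  hY.span ▸ Submodule.subset_span ⟨α, rfl⟩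

section Basis

variable {ι : Type*} [Fintype ι] {Y : ι → so m}

theorem sum_ip_smul_of_mem (hY : IsOrthonormalBasis Y) {Z : so m} (hZ : Z ∈ hAlg m) :
    ∑ α, ip (Y α) Z • Y α = Z := by
  rw [← hY.span] at hZ
  induction hZ using Submodule.span_induction with
  | mem X hX =>
    obtain ⟨β, rfl⟩ := hX
    rw [Finset.sum_eq_single β]
    · rw [(hY.orthonormal β β).1 rfl, one_smul]
    · intro α _ h
      rw [(hY.orthonormal α β).2 h, zero_smul]
    · simp
  | zero => simp [ip_zero]
  | add X X' _ _ h h' => simp only [ip_add, add_smul, Finset.sum_add_distrib, h, h']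
  | smul r X _ h => simp only [ip_smul, mul_smul, ← Finset.smul_sum, h]

/-- Removes the basis: ω, L and J_H all become 1 − `perp` applied to a vector in the space frame. -/
theorem sum_ip_smul (hY : IsOrthonormalBasis Y) (X : so m) :
    ∑ α, ip (Y α) X • Y α = X - perp X := by
  rw [← sum_ip_smul_of_mem hY (sub_perp_mem_hAlg X)]
  refine Finset.sum_congr rfl fun α _ => ?_
  rw [ip_sub, ← ip_perp_left, (mem_hAlg_iff_perp _).1 (hY.mem α), zero_ip, sub_zero]

theorem L_eq (hY : IsOrthonormalBasis Y) (x : TS m) :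
    L Y x = Ad x.1 x.2 - perp (Ad x.1 x.2) :=
  sum_ip_smul hY _

theorem JH_eq (I : so m →ₗ[ℝ] so m) (hY : IsOrthonormalBasis Y) (x : TS m) :
    JH I Y x = Ad x.1 (I x.2) - perp (Ad x.1 (I x.2)) :=
  sum_ip_smul hY _

/-- In a symmetric pair the 𝔥-part of [a,b] is the bracket of the 𝔥-parts plus the bracket of the
𝔥^⊥-parts; the quadratic term of the curvature cancels the former. -/
theorem Curv_eq (hY : IsOrthonormalBasis Y) (s : SO m) (v w : so m) :
    Curv Y s v w = lie (perp (Ad s v)) (perp (Ad s w)) := by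
  have ho : omega Y = fun s u => (LinearMap.id - perp : so m →ₗ[ℝ] so m) (Ad s u) :=
    funext fun s => funext fun u => sum_ip_smul hY (Ad s u)
  have hv := sub_perp_mem_hAlg (Ad s v)
  have hw := sub_perp_mem_hAlg (Ad s w)
  rw [Curv, ho, dS_linear_Ad]
  set a := Ad s v
  set b := Ad s w
  have h1 := perp_lie_of_mem_hAlg hv b
  have h2 := perp_lie_of_mem_hAlg hw (perp a)
  have h3 := perp_lie_perp_perp a b
  -- Arranged so that every bracket either has its left entry in 𝔥 or is taken inside 𝔥^⊥, where the
  -- action of `perp` is known.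
  have e1 : lie a b = lie (a - perp a) b - lie (b - perp b) (perp a)
      + lie (perp a) (perp b) := by
    refine Subtype.ext ?_
    simp only [lie, Submodule.coe_add, Submodule.coe_sub]
    noncomm_ring
  have e2 : perp (lie a b) = lie (a - perp a) (perp b) - lie (b - perp b) (perp a) := by
    rw [e1, map_add, map_sub, h1, h2, h3, perp_perp, add_zero]
  rw [LinearMap.sub_apply, LinearMap.id_apply, e2]
  refine Subtype.ext ?_
  simp only [lie, Submodule.coe_sub, LinearMap.sub_apply, LinearMap.id_apply]
  noncomm_ring

/-- The curvature takes values in 𝔥, so L may be replaced by the whole of Ad(s)u. -/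
theorem OmegaTilde_apply (I : so m →ₗ[ℝ] so m) (hY : IsOrthonormalBasis Y) (x : TS m)
    (U W : TT m) :
    OmegaTilde I Y x U W = OmegaS I x U W
      - ip (Ad x.1 x.2) (lie (perp (Ad x.1 U.1)) (perp (Ad x.1 W.1))) := by
  rw [OmegaTilde, L_eq hY, Curv_eq hY, sub_ip, ip_perp_left, perp_lie_perp_perp, ip_zero, sub_zero]

end Basis

end Formulas

/-! ### Non-degeneracy of semi-basic perturbations of Ω^S. -/

section Nondegenerate

variable {m : ℕ}

theorem metric₀_comm {I : so m →ₗ[ℝ] so m} (hI : IsInertia I) (s : SO m) (u v : so m) :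
    metric₀ I s u v = metric₀ I s v u := by
  rw [metric₀_apply, metric₀_apply, hI.symm, ip_comm, ip_perp_left, ip_comm (Ad s u)]

theorem metric₀_self_pos {I : so m →ₗ[ℝ] so m} (hI : IsInertia I) (s : SO m) (u : so m)
    (hu : u ≠ 0) : 0 < metric₀ I s u u := by
  rw [metric₀_apply, ← inner_lastColumn]
  exact add_pos_of_pos_of_nonneg (hI.pos u hu) real_inner_self_nonneg

theorem metric₀_sub (I : so m →ₗ[ℝ] so m) (s : SO m) (u v w : so m) :
    metric₀ I s u (v - w) = metric₀ I s u v - metric₀ I s u w := by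
  simp only [metric₀_apply, sub_eq_add_neg, Ad_add, Ad_neg, ip_add, ip_neg]
  ring

theorem metric₀_zero_left (I : so m →ₗ[ℝ] so m) (s : SO m) (u : so m) :
    metric₀ I s 0 u = 0 := by
  simp [metric₀_apply, Ad_zero, zero_ip]

/-- Changing the canonical symplectic form by a semi-basic two-form keeps it non-degenerate. -/
theorem exists_nondegenerate_bilinForm {I : so m →ₗ[ℝ] so m} (hI : IsInertia I) (x : TS m)
    (C : LinearMap.BilinForm ℝ (so m)) (hC : C.IsAlt) :
    ∃ B : LinearMap.BilinForm ℝ (TT m),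
      (∀ U W, B U W = OmegaS I x U W + C U.1 W.1) ∧ B.IsAlt ∧ B.Nondegenerate := by
  let B : LinearMap.BilinForm ℝ (TT m) :=
    LinearMap.mk₂ ℝ (fun U W => OmegaS I x U W + C U.1 W.1)
      (fun U U' W => by
        simp only [OmegaS_apply, metric₀_apply, Prod.fst_add, Prod.snd_add, Ad_add, map_add,
          add_ip, ip_add, add_lie, LinearMap.add_apply]
        ring)
      (fun r U W => by
        simp only [OmegaS_apply, metric₀_apply, Prod.smul_fst, Prod.smul_snd, Ad_smul, map_smul,
          smul_ip, ip_smul, smul_lie, LinearMap.smul_apply, smul_eq_mul]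
        ring)
      (fun U W W' => by
        simp only [OmegaS_apply, metric₀_apply, Prod.fst_add, Prod.snd_add, Ad_add, map_add,
          add_ip, ip_add, lie_add, add_lie]
        ring)
      (fun r U W => by
        simp only [OmegaS_apply, metric₀_apply, Prod.smul_fst, Prod.smul_snd, Ad_smul, map_smul,
          smul_ip, ip_smul, lie_smul, smul_lie, smul_eq_mul]
        ring)
  have hB : ∀ U W, B U W = OmegaS I x U W + C U.1 W.1 := fun U W => rfl
  have hAlt : B.IsAlt := fun U => by
    rw [hB, hC U.1, OmegaS_apply]
    simp [lie_self, ip_zero]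
  refine ⟨B, hB, hAlt, hAlt.isRefl.nondegenerate_iff_separatingLeft.2 fun U hU => ?_⟩
  have h1 : U.1 = 0 := by
    by_contra h
    -- A vertical test vector is invisible to `C` and leaves only μ₀(U.1, U.1). Once U.1 = 0, the
    -- test vector (U.2, 0) below leaves only −μ₀(U.2, U.2).
    have h2 := hU (0, U.1)
    rw [hB, OmegaS_apply] at h2
    simp only [lie_zero, ip_zero, map_zero, Ad_zero, zero_lie, zero_ip] at h2
    have h3 : metric₀ I x.1 U.2 0 = 0 := by rw [metric₀_comm hI, metric₀_zero_left]
    have := metric₀_self_pos hI x.1 U.1 h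
    linarith
  have h2 : U.2 = 0 := by
    by_contra h
    have h2 := hU (U.2, 0)
    rw [hB, OmegaS_apply, h1] at h2
    simp only [zero_lie, ip_zero, map_zero, Ad_zero, zero_ip, metric₀_zero_left,
      LinearMap.zero_apply] at h2
    have := metric₀_self_pos hI x.1 U.2 h
    linarith
  exact Prod.ext h1 h2

theorem exists_bilinForm_OmegaTilde {I : so m →ₗ[ℝ] so m} (hI : IsInertia I) {ι : Type*} [Fintype ι]
    {Y : ι → so m} (hY : IsOrthonormalBasis Y) (x : TS m) :
    ∃ B : LinearMap.BilinForm ℝ (TT m),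
      (∀ U W, B U W = OmegaTilde I Y x U W) ∧ B.IsAlt ∧ B.Nondegenerate := by
  let C : LinearMap.BilinForm ℝ (so m) :=
    LinearMap.mk₂ ℝ (fun v w => -ip (Ad x.1 x.2) (lie (perp (Ad x.1 v)) (perp (Ad x.1 w))))
      (fun _ _ _ => by simp only [Ad_add, map_add, add_lie, ip_add]; ring)
      (fun _ _ _ => by simp only [Ad_smul, map_smul, smul_lie, ip_smul, smul_eq_mul]; ring)
      (fun _ _ _ => by simp only [Ad_add, map_add, lie_add, ip_add]; ring)
      (fun _ _ _ => by simp only [Ad_smul, map_smul, lie_smul, ip_smul, smul_eq_mul]; ring)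
  have hC : C.IsAlt := fun v => by
    change -ip _ (lie _ _) = 0
    rw [lie_self, ip_zero, neg_zero]
  obtain ⟨B, hB, h⟩ := exists_nondegenerate_bilinForm hI x C hC
  refine ⟨B, fun U W => ?_, h⟩
  rw [hB, OmegaTilde_apply I hY, sub_eq_add_neg]
  rfl

theorem exists_bilinForm_OmegaNh {I : so m →ₗ[ℝ] so m} (hI : IsInertia I) (x : TS m) :
    ∃ B : LinearMap.BilinForm ℝ (TT m),
      (∀ U W, B U W = OmegaNh I x U W) ∧ B.IsAlt ∧ B.Nondegenerate := by
  let C : LinearMap.BilinForm ℝ (so m) :=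
    LinearMap.mk₂ ℝ (fun v w => ip (perp (Ad x.1 x.2)) (lie (Ad x.1 v) (Ad x.1 w)))
      (fun _ _ _ => by simp only [Ad_add, add_lie, ip_add])
      (fun _ _ _ => by simp only [Ad_smul, smul_lie, ip_smul, smul_eq_mul])
      (fun _ _ _ => by simp only [Ad_add, lie_add, ip_add])
      (fun _ _ _ => by simp only [Ad_smul, lie_smul, ip_smul, smul_eq_mul])
  have hC : C.IsAlt := fun v => by
    change ip _ (lie _ _) = 0
    rw [lie_self, ip_zero]
  obtain ⟨B, hB, h⟩ := exists_nondegenerate_bilinForm hI x C hC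
  refine ⟨B, fun U W => ?_, h⟩
  rw [hB, OmegaNh_apply]
  rfl

end Nondegenerate

/-! ### Smoothness, failure of closedness and invariance of Ω̃. -/

section Truncated

variable {m : ℕ} {I : so m →ₗ[ℝ] so m} {ι : Type*} [Fintype ι] {Y : ι → so m}

theorem smooth_OmegaTilde (I : so m →ₗ[ℝ] so m) (hY : IsOrthonormalBasis Y) (U W : TT m) :
    Smooth (fun x => OmegaTilde I Y x U W) := by
  intro x
  have hu : ContDiff ℝ ∞ (fun p : TT m => (chart x p).2) := contDiff_const.add contDiff_snd
  have hA : ∀ {g : TT m → so m}, ContDiff ℝ ∞ g →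
      ContDiff ℝ ∞ (fun p : TT m => Ad (chart x p).1 (g p)) := fun hg =>
    contDiff_Ad x.1 contDiff_fst hg
  have hT : ∀ (T : so m →ₗ[ℝ] so m) {g : TT m → so m}, ContDiff ℝ ∞ g →
      ContDiff ℝ ∞ (fun p : TT m => T (g p)) := fun T _ hg =>
    T.toContinuousLinearMap.contDiff.comp hg
  have hAu := hA hu
  have hAc : ∀ a : so m, ContDiff ℝ ∞ (fun p : TT m => Ad (chart x p).1 a) := fun a =>
    hA contDiff_const
  have hc : ∀ a : so m, ContDiff ℝ ∞ (fun _ : TT m => a) := fun a => contDiff_const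
  have hm : ∀ a b : so m, ContDiff ℝ ∞ (fun p : TT m => metric₀ I (chart x p).1 a b) := by
    intro a b
    simp only [metric₀_apply]
    exact contDiff_const.add (contDiff_ip (hT _ (hAc a)) (hAc b))
  simp only [OmegaTilde_apply I hY, OmegaS_apply]
  exact ((((((hm _ _).sub (hm _ _)).add (contDiff_ip (hT I hu) (hc _))).sub
    (contDiff_ip (hT _ hAu) (contDiff_lie (hAc _) (hAc _)))).sub
    (contDiff_ip (contDiff_lie (hAc _) hAu) (hT _ (hAc _)))).add
    (contDiff_ip (contDiff_lie (hAc _) hAu) (hT _ (hAc _)))).sub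
    (contDiff_ip hAu (contDiff_lie (hT _ (hAc _)) (hT _ (hAc _))))

theorem smooth_JH (I : so m →ₗ[ℝ] so m) (hY : IsOrthonormalBasis Y) : Smooth (JH I Y) := by
  intro x
  have hu : ContDiff ℝ ∞ (fun p : TT m => (chart x p).2) := contDiff_const.add contDiff_snd
  have hA : ContDiff ℝ ∞ (fun p : TT m => Ad (chart x p).1 (I (chart x p).2)) :=
    contDiff_Ad x.1 contDiff_fst (I.toContinuousLinearMap.contDiff.comp hu)
  simp only [JH_eq I hY]
  exact hA.sub ((perp (m := m)).toContinuousLinearMap.contDiff.comp hA)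

/-- The contributions of the exact form Ω^S cancel; what survives is the fibre derivative of the
curvature term, which is linear in u. -/
theorem d₂_OmegaTilde_semibasic (hI : IsInertia I) (hY : IsOrthonormalBasis Y) (x : TS m)
    (a b c : so m) :
    d₂ (OmegaTilde I Y) x (a, 0) (b, 0) (0, c) =
      -ip (Ad x.1 c) (lie (perp (Ad x.1 a)) (perp (Ad x.1 b))) := by
  have hm0 : ∀ (s : SO m) (v : so m), metric₀ I s v 0 = 0 := fun s v => by
    rw [metric₀_comm hI, metric₀_zero_left]
  have hBC : ∀ (y : TS m) (v : so m), OmegaTilde I Y y (v, 0) (0, c) = metric₀ I y.1 c v := by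
    intro y v
    simp [OmegaTilde_apply I hY, OmegaS_apply, Ad_zero, lie_zero, zero_lie, ip_zero, zero_ip, hm0]
  have hCA : ∀ (y : TS m) (v : so m), OmegaTilde I Y y (0, c) (v, 0) = -metric₀ I y.1 c v := by
    intro y v
    simp [OmegaTilde_apply I hY, OmegaS_apply, Ad_zero, zero_lie, ip_zero, zero_ip, hm0]
  have hAB : ∀ y : TS m, OmegaTilde I Y y (a, 0) (b, 0) = ip (I y.2) (lie a b)
      - ip (perp (Ad y.1 y.2)) (lie (Ad y.1 a) (Ad y.1 b))
      - ip (lie (Ad y.1 a) (Ad y.1 y.2)) (perp (Ad y.1 b))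
      + ip (lie (Ad y.1 b) (Ad y.1 y.2)) (perp (Ad y.1 a))
      - ip (Ad y.1 y.2) (lie (perp (Ad y.1 a)) (perp (Ad y.1 b))) := by
    intro y
    simp [OmegaTilde_apply I hY, OmegaS_apply, metric₀_zero_left]
  have hD : ∀ v w : so m, HasDerivAt (fun t : ℝ => metric₀ I (chart x (t • ((v, 0) : TT m))).1 c w)
      (ip (perp (lie (Ad x.1 v) (Ad x.1 c))) (Ad x.1 w)
        + ip (perp (Ad x.1 c)) (lie (Ad x.1 v) (Ad x.1 w))) 0 := by
    intro v w
    simp only [metric₀_apply]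
    have h := (hasDerivAt_const (0 : ℝ) (ip (I c) w)).add (hasDerivAt_ip
      (hasDerivAt_linear perp (hasDerivAt_Ad_chart_const x (v, 0) c))
      (hasDerivAt_Ad_chart_const x (v, 0) w))
    simp only [chart_zero_smul, zero_add] at h
    exact h
  have hD1 : D (fun y => OmegaTilde I Y y (b, 0) (0, c)) x (a, 0) =
      ip (perp (lie (Ad x.1 a) (Ad x.1 c))) (Ad x.1 b)
        + ip (perp (Ad x.1 c)) (lie (Ad x.1 a) (Ad x.1 b)) := by
    simp only [hBC]
    exact D_eq_of_hasDerivAt (hD a b)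
  have hD2 : D (fun y => OmegaTilde I Y y (0, c) (a, 0)) x (b, 0) =
      -(ip (perp (lie (Ad x.1 b) (Ad x.1 c))) (Ad x.1 a)
        + ip (perp (Ad x.1 c)) (lie (Ad x.1 b) (Ad x.1 a))) := by
    simp only [hCA]
    exact D_eq_of_hasDerivAt (hD b a).neg
  have hfst : ∀ t : ℝ, (chart x (t • ((0, c) : TT m))).1 = x.1 := by
    intro t
    simp [chart, expSO_zero]
  have hD3 : D (fun y => OmegaTilde I Y y (a, 0) (b, 0)) x (0, c) = ip (I c) (lie a b)
      - ip (perp (Ad x.1 c)) (lie (Ad x.1 a) (Ad x.1 b))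
      - ip (lie (Ad x.1 a) (Ad x.1 c)) (perp (Ad x.1 b))
      + ip (lie (Ad x.1 b) (Ad x.1 c)) (perp (Ad x.1 a))
      - ip (Ad x.1 c) (lie (perp (Ad x.1 a)) (perp (Ad x.1 b))) := by
    -- In a fibre direction s is fixed and the form on base vectors is linear in u, so its
    -- derivative is its value at u = c.
    let T : so m →ₗ[ℝ] ℝ :=
      { toFun := fun u => OmegaTilde I Y (x.1, u) (a, 0) (b, 0)
        map_add' := fun u v => by
          simp only [hAB, Ad_add, map_add, add_ip, lie_add]
          ring
        map_smul' := fun r u => by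
          simp only [hAB, Ad_smul, map_smul, smul_ip, lie_smul, smul_eq_mul, RingHom.id_apply]
          ring }
    have h := hasDerivAt_linear T (hasDerivAt_chart_snd x (0, c))
    have h' : HasDerivAt (fun t : ℝ => OmegaTilde I Y (chart x (t • ((0, c) : TT m))) (a, 0) (b, 0))
        (T c) 0 := by
      refine h.congr_of_eventuallyEq (.of_forall fun t => ?_)
      change _ = OmegaTilde I Y (x.1, _) _ _
      rw [← hfst t]
    rw [D_eq_of_hasDerivAt h']
    exact hAB (x.1, c)
  rw [d₂, hD1, hD2, hD3]
  simp only [bracketTT, lie_zero, zero_lie, hBC]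
  have h0 : ∀ W, OmegaTilde I Y x (0, 0) W = 0 := by
    intro W
    obtain ⟨B, hB, -⟩ := exists_bilinForm_OmegaTilde hI hY x
    rw [← hB, Prod.mk_zero_zero, map_zero, LinearMap.zero_apply]
  rw [h0, h0, metric₀_apply, Ad_lie, ip_perp_left (lie _ _), ip_perp_left (lie _ _),
    lie_neg_swap (Ad x.1 b) (Ad x.1 a), ip_neg]
  ring

theorem isAlmostSymplectic_OmegaTilde (hm : 3 ≤ m + 1) (hI : IsInertia I)
    (hY : IsOrthonormalBasis Y) : IsAlmostSymplectic (OmegaTilde I Y) where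
  form x := exists_bilinForm_OmegaTilde hI hY x
  smooth U W := smooth_OmegaTilde I hY U W
  not_closed h := by
    obtain ⟨a, b, hab⟩ := exists_lie_perp_ne_zero hm
    -- At s = 1 this choice of c turns the formula into minus the squared norm of a non-zero
    -- bracket.
    have h1 := h (1, 0) (a, 0) (b, 0) (0, lie (perp a) (perp b))
    rw [d₂_OmegaTilde_semibasic hI hY] at h1
    simp only [Ad_one, neg_eq_zero] at h1
    exact (ip_self_pos _ hab).ne' h1

/-- Both h and its transpose fix e_n, so h commutes with `lastProj`. -/
theorem perp_Ad_of_mem_H {h : SO m} (hh : h ∈ H m) (X : so m) :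
    perp (Ad h X) = Ad h (perp X) := by
  have hE : (h : Mat m) * lastProj m = lastProj m := by
    have h1 : (h : Mat m) *ᵥ Pi.single (Fin.last m) 1 = Pi.single (Fin.last m) 1 := hh
    have h2 : ((h : Mat m) - 1) * lastProj m = 0 := by
      rw [mul_lastProj_eq_zero_iff, Matrix.sub_mulVec, h1, Matrix.one_mulVec, sub_self]
    rwa [sub_mul, one_mul, sub_eq_zero] at h2
  have hE' : lastProj m * (h : Mat m)ᵀ = lastProj m := by
    have := congrArg Matrix.transpose hE
    rwa [Matrix.transpose_mul, lastProj_transpose] at this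
  have hE2 : (h : Mat m)ᵀ * lastProj m = lastProj m := by
    conv_lhs => rw [← hE, ← Matrix.mul_assoc, SO_transpose_mul, Matrix.one_mul]
  have hE2' : lastProj m * (h : Mat m) = lastProj m := by
    have := congrArg Matrix.transpose hE2
    rwa [Matrix.transpose_mul, lastProj_transpose, Matrix.transpose_transpose] at this
  refine Subtype.ext ?_
  simp only [coe_perp, Ad, mul_add, add_mul]
  congr 1
  · simp only [Matrix.mul_assoc, hE2, hE']
  · simp only [← Matrix.mul_assoc, hE, hE2']

theorem isHInvariant_OmegaTilde (I : so m →ₗ[ℝ] so m) (hY : IsOrthonormalBasis Y) :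
    IsHInvariant (OmegaTilde I Y) := by
  intro h hh x U W
  simp only [OmegaTilde_apply I hY, OmegaS_apply, metric₀_apply, leftAct, Ad_mul,
    perp_Ad_of_mem_H hh, ← Ad_lie, ip_Ad]

/-! ### The non-holonomic field and the momentum map. -/

theorem D_Hc {I : so m →ₗ[ℝ] so m} (hI : IsInertia I) (x : TS m) (W : TT m) :
    D (Hc I) x W = metric₀ I x.1 x.2 W.2
      + ip (perp (Ad x.1 x.2)) (lie (Ad x.1 W.1) (Ad x.1 x.2)) := by
  have hu := hasDerivAt_chart_snd x W
  have hA := hasDerivAt_Ad_chart_snd x W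
  have h := ((hasDerivAt_ip (hasDerivAt_linear I hu) hu).add
    (hasDerivAt_ip (hasDerivAt_linear perp hA) hA)).const_mul (1 / 2)
  have hf : Hc I = fun y => 1 / 2 * (ip (I y.2) y.2 + ip (perp (Ad y.1 y.2)) (Ad y.1 y.2)) :=
    funext (Hc_apply I)
  rw [hf, D_eq_of_hasDerivAt h]
  simp only [chart_zero_smul, ip_perp_left (_ + _)]
  rw [hI.symm, ip_comm _ (I _), ip_comm _ (perp _), metric₀_apply, ip_add]
  ring

theorem exists_nonholonomic_field (hI : IsInertia I) :
    ∃ Xnh : TS m → TT m, ∀ X, IsHamiltonianField (OmegaNh I) (Hc I) X ↔ X = Xnh := by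
  choose B hB _ hN using exists_bilinForm_OmegaNh hI
  -- `D` is a derivative along single curves, so its linearity in the direction is read off from the
  -- explicit formula.
  let f : TS m → TT m →ₗ[ℝ] ℝ := fun x =>
    { toFun := fun W => D (Hc I) x W
      map_add' := fun U W => by
        simp only [D_Hc hI, metric₀_apply, Prod.fst_add, Prod.snd_add, Ad_add, add_lie, ip_add]
        ring
      map_smul' := fun r W => by
        simp only [D_Hc hI, metric₀_apply, Prod.smul_fst, Prod.smul_snd, Ad_smul, smul_lie, ip_smul,
          RingHom.id_apply, smul_eq_mul]
        ring }
  refine ⟨fun x => ((B x).toDual (hN x)).symm (f x), fun X => ?_⟩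
  constructor
  · intro hX
    funext x
    rw [LinearEquiv.eq_symm_apply]
    exact LinearMap.ext fun W => (hB x _ W).trans (hX x W)
  · rintro rfl x W
    rw [← hB, LinearMap.BilinForm.apply_toDual_symm_apply]
    rfl

/-- The non-holonomic vector field is of second order. -/
theorem fst_of_isHamiltonianField_OmegaNh (hI : IsInertia I) {X : TS m → TT m}
    (hX : IsHamiltonianField (OmegaNh I) (Hc I) X) (x : TS m) : (X x).1 = x.2 := by
  by_contra hne
  have hm0 : ∀ v : so m, metric₀ I x.1 v 0 = 0 := fun v => by
    rw [metric₀_comm hI, metric₀_zero_left]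
  -- On vertical vectors the equation of motion reads μ₀(W.2, X.1) = μ₀(u, W.2); this W then gives
  -- μ₀ of X.1 − u with itself equal to zero.
  have h := hX x (0, (X x).1 - x.2)
  have hpos := metric₀_self_pos hI x.1 _ (sub_ne_zero.2 hne)
  rw [OmegaNh_apply, OmegaS_apply, D_Hc hI] at h
  simp only [Ad_zero, map_zero, lie_zero, zero_lie, ip_zero, zero_ip, hm0] at h
  rw [metric₀_sub, metric₀_comm hI x.1 _ x.2] at hpos
  linarith

/-- By invariance both corrections pair −[a,P a] with b, one of them through P b. Since [a,P a] = [a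
− P a,P a] lies in 𝔥^⊥, that projection is harmless. -/
theorem OmegaNh_eq_OmegaTilde_of_fst (I : so m →ₗ[ℝ] so m) (hY : IsOrthonormalBasis Y)
    (x : TS m) (U W : TT m) (hU : U.1 = x.2) : OmegaNh I x U W = OmegaTilde I Y x U W := by
  rw [OmegaNh_apply, OmegaTilde_apply I hY, hU]
  set a := Ad x.1 x.2
  set b := Ad x.1 W.1
  have h1 := perp_lie_of_mem_hAlg (sub_perp_mem_hAlg a) (perp a)
  have hl : ∀ c : so m, lie (a - perp a) c = lie a c - lie (perp a) c := fun c =>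
    Subtype.ext (by simp only [lie, Submodule.coe_sub]; noncomm_ring)
  rw [perp_perp, hl, lie_self, sub_zero] at h1
  have h2 : ip (perp a) (lie a b) = -ip (lie a (perp a)) b := by
    rw [← ip_lie_left, lie_neg_swap, neg_ip]
  have h3 : ip a (lie (perp a) (perp b)) = ip (lie a (perp a)) b := by
    rw [← ip_lie_left, ← ip_perp_left, h1]
  rw [h2, h3]
  ring

theorem isMomentumMap_JH (I : so m →ₗ[ℝ] so m) (hY : IsOrthonormalBasis Y) :
    IsMomentumMap (OmegaTilde I Y) (JH I Y) where
  mem x := by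
    rw [JH_eq I hY]
    exact sub_perp_mem_hAlg _
  smooth := smooth_JH I hY
  hamiltonian := by
    intro Z hZ x W
    have hZ0 := (mem_hAlg_iff_perp Z).1 hZ
    have hJ : (fun y : TS m => ip (JH I Y y) Z) = fun y => ip (Ad y.1 (I y.2)) Z := by
      funext y
      rw [JH_eq I hY, sub_ip, ip_perp_left, hZ0, ip_zero, sub_zero]
    have hD := D_eq_of_hasDerivAt (f := fun y : TS m => ip (Ad y.1 (I y.2)) Z)
      (hasDerivAt_ip (hasDerivAt_Ad_chart x W (hasDerivAt_linear I (hasDerivAt_chart_snd x W)))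
        (hasDerivAt_const (0 : ℝ) Z))
    rw [hJ, hD, OmegaTilde_apply I hY, OmegaS_apply]
    have h1 : metric₀ I x.1 W.2 (Ad x.1⁻¹ Z) = ip (Ad x.1 (I W.2)) Z := by
      rw [metric₀_apply, Ad_inv_cancel, ip_perp_left, hZ0, ip_zero, add_zero, ← ip_Ad x.1,
        Ad_inv_cancel]
    have h2 : ip (I x.2) (lie (Ad x.1⁻¹ Z) W.1) = ip (lie (Ad x.1 W.1) (Ad x.1 (I x.2))) Z := by
      rw [← ip_Ad x.1, Ad_lie, Ad_inv_cancel, ← ip_lie_left, ip_comm, ← ip_lie_left]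
    -- For Z in 𝔥, ad Z commutes with `perp` and is skew, so the two terms from the translational
    -- energy cancel.
    have h3 : ip (lie Z (Ad x.1 x.2)) (perp (Ad x.1 W.1)) =
        -ip (perp (Ad x.1 x.2)) (lie Z (Ad x.1 W.1)) := by
      rw [← ip_perp_left, perp_lie_of_mem_hAlg hZ, lie_neg_swap, neg_ip, ip_lie_left]
    simp only [generator, chart_zero_smul, Ad_inv_cancel, metric₀_zero_left, hZ0, zero_lie,
      ip_zero, add_ip, h1, h2, h3]
    ring

end Truncated

end Chaplygin

end

theorem theorem4p1 {m : ℕ} (hm : 3 ≤ m + 1)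
    (I : Chaplygin.so m →ₗ[ℝ] Chaplygin.so m) (hI : Chaplygin.IsInertia I)
    {ι : Type*} [Fintype ι] (Y : ι → Chaplygin.so m) (hY : Chaplygin.IsOrthonormalBasis Y) :
    (Chaplygin.IsAlmostSymplectic (Chaplygin.OmegaTilde I Y) ∧
      Chaplygin.IsHInvariant (Chaplygin.OmegaTilde I Y)) ∧
    (∃ Xnh : Chaplygin.TS m → Chaplygin.TT m,
      (∀ X, Chaplygin.IsHamiltonianField (Chaplygin.OmegaNh I) (Chaplygin.Hc I) X ↔ X = Xnh) ∧
      Chaplygin.IsHamiltonianField (Chaplygin.OmegaTilde I Y) (Chaplygin.Hc I) Xnh) ∧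
    Chaplygin.IsMomentumMap (Chaplygin.OmegaTilde I Y) (Chaplygin.JH I Y) := by
  obtain ⟨Xnh, hX⟩ := Chaplygin.exists_nonholonomic_field hI
  have hXnh := (hX Xnh).2 rfl
  refine ⟨⟨Chaplygin.isAlmostSymplectic_OmegaTilde hm hI hY,
    Chaplygin.isHInvariant_OmegaTilde I hY⟩, ⟨Xnh, hX, fun x W => ?_⟩,
    Chaplygin.isMomentumMap_JH I hY⟩
  rw [← Chaplygin.OmegaNh_eq_OmegaTilde_of_fst I hY x _ W
    (Chaplygin.fst_of_isHamiltonianField_OmegaNh hI hXnh x)]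
  exact hXnh x W
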